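/- Fix countably infinite sets of places and of actions. A PN system (labelled Petri net) is a finite set $\Delta$ of rules $\alpha \xrightarrow{a} \beta$, where $\alpha,\beta$ are finite multisets of places and $a$ is an action. Its markings (PN processes) are the finite multisets of places appearing in its rules, and its transitions are $\alpha+\gamma \xrightarrow{a} \beta+\gamma$ for every rule $\alpha \xrightarrow{a} \beta$ of $\Delta$ and every finite multiset $\gamma$. Let $\sim$ denote strong bisimilarity, and let $\mathbf{PN}\sim\mathbf{PN}$ be the problem: given PN systems $\Delta_1,\Delta_2$ and markings $\alpha$ of $\Delta_1$ and $\beta$ of $\Delta_2$, does $\alpha\sim\beta$ hold (in the disjoint union of the two transition systems)? A (Minsky) counter machine $\mathcal M$ with nonnegative counters $c_1,\dots,c_m$ is a sequence of instructions $1{:}\,\mathrm{INS}_1;\ \dots;\ n{-}1{:}\,\mathrm{INS}_{n-1};\ n{:}\,\mathtt{halt}$, where each $\mathrm{INS}_i$ is either $c_j:=c_j+1;\ \mathtt{goto}\ k$, or $\mathtt{if}\ c_j=0\ \mathtt{then\ goto}\ k\ \mathtt{else}\ (c_j:=c_j-1;\ \mathtt{goto}\ l)$, with $1\le j\le m$ and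 $1\le k,l\le n$. Let $\mathcal N_{\mathcal M}$ be the net over the places $C_1,\dots,C_m,Q_1,\dots,Q_n,Q'_1,\dots,Q'_n$ with the following rules (multisets are written with $\|$): for each instruction $i$ of the first form, $Q_i\xrightarrow{inc}Q_k\|C_j$ and $Q'_i\xrightarrow{inc}Q'_k\|C_j$; for each instruction $i$ of the second form, $Q_i\|C_j\xrightarrow{dec}Q_l$, $Q'_i\|C_j\xrightarrow{dec}Q'_l$, $Q_i\xrightarrow{zer}Q_k$, $Q'_i\xrightarrow{zer}Q'_k$, $Q_i\|C_j\xrightarrow{zer}Q'_k\|C_j$ and $Q'_i\|C_j\xrightarrow{zer}Q_k\|C_j$; and finally $Q_n\xrightarrow{hlt}\varnothing$. Then: 1. $\mathbf{PN}\sim\mathbf{PN}$ is undecidable. 2. The map taking $\mathcal M$ to the instance of $\mathbf{PN}\sim\mathbf{PN}$ that consists of $\mathcal N_{\mathcal M}$ with one token in $Q_1$ and $\mathcal N_{\mathcal M}$ with one token in $Q'_1$ is computable. For every counter machine $\mathcal M$, the marking of $\mathcal N_{\mathcal M}$ with one token in $Q_1$ and zero elsewhere is bisimilar to the marking with one token in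 $Q'_1$ and zero elsewhere if and only if $\mathcal M$, started at instruction $1$ with all counters zero, does not halt. 3. $\mathbf{PN}\sim\mathbf{PN}$ is $\Pi^0_1$-complete under computable many-one reductions. -/

import Mathlib

/-! ### Transition systems and strong bisimilarity -/

/-- A transition system with actions in `A`. -/
structure LTS (A : Type) where
  State : Type
  Tr : State → A → State → Prop

namespace LTS

variable {A : Type}

def IsBisimulation (T : LTS A) (R : T.State → T.State → Prop) : Prop :=
  ∀ s t, R s t → ∀ a,
    (∀ s', T.Tr s a s' → ∃ t', T.Tr t a t' ∧ R s' t') ∧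
    (∀ t', T.Tr t a t' → ∃ s', T.Tr s a s' ∧ R s' t')

/-- `s ∼ t` for two states of the same transition system. -/
def Bisimilar (T : LTS A) (s t : T.State) : Prop :=
  ∃ R : T.State → T.State → Prop, T.IsBisimulation R ∧ R s t

/-- Disjoint union of transition systems; labels are preserved. -/
def disjointUnion (T U : LTS A) : LTS A where
  State := T.State ⊕ U.State
  Tr
    | Sum.inl s, a, Sum.inl s' => T.Tr s a s'
    | Sum.inr u, a, Sum.inr u' => U.Tr u a u'
    | _, _, _ => False

end LTS

/-! ### Petri nets (PN systems)

Process constants (places) and actions both range over `ℕ`. A parallel expression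
`X₁ ‖ ⋯ ‖ Xₙ` is written as the list `[X₁, …, Xₙ]`; modulo structural congruence it is the
multiset of its constants, that is, a marking. -/

/-- `(α, a, β)` is the rule `α –a→ β` between parallel expressions `α` and `β`. -/
abbrev PNRule : Type := List ℕ × ℕ × List ℕ

/-- A PN system, i.e. a finite set of rules, presented by a list of its elements. -/
abbrev PNSystem : Type := List PNRule

namespace PNSystem

/-- `x` is a place of `Δ`: it appears in some rule of `Δ`. -/
def IsPlace (Δ : PNSystem) (x : ℕ) : Prop :=
  ∃ r ∈ Δ, x ∈ r.1 ∨ x ∈ r.2.2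

/-- `m` is a state of the transition system of `Δ`: a multiset of places of `Δ`. -/
def IsMarking (Δ : PNSystem) (m : Multiset ℕ) : Prop :=
  ∀ x ∈ m, Δ.IsPlace x

/-- The firing relation: a rule `α –a→ β` of `Δ` gives `α ‖ γ –a→ β ‖ γ` for every `γ`. -/
def Fires (Δ : PNSystem) (m : Multiset ℕ) (a : ℕ) (m' : Multiset ℕ) : Prop :=
  ∃ r ∈ Δ, ∃ γ : Multiset ℕ,
    m = (r.1 : Multiset ℕ) + γ ∧ a = r.2.1 ∧ m' = (r.2.2 : Multiset ℕ) + γ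

/-- The transition system of `Δ`. For convenience all multisets of constants are allowed as
states; the markings of `Δ` form a subset that is closed under transitions
(`IsMarking.of_fires`), so bisimilarity of two markings is not affected by the others. -/
def toLTS (Δ : PNSystem) : LTS ℕ where
  State := Multiset ℕ
  Tr := Δ.Fires

theorem IsMarking.of_fires {Δ : PNSystem} {m m' : Multiset ℕ} {a : ℕ}
    (hm : Δ.IsMarking m) (h : Δ.Fires m a m') : Δ.IsMarking m' := by
  obtain ⟨r, hr, γ, rfl, -, rfl⟩ := h
  intro x hx
  rcases Multiset.mem_add.1 hx with hx | hx
  · exact ⟨r, hr, Or.inr (Multiset.mem_coe.1 hx)⟩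
  · exact hm x (Multiset.mem_add.2 (Or.inr hx))

end PNSystem

/-- An instance of the problem PN ∼ PN: two PN systems, each with a parallel expression
(a multiset of constants, presented by a list). -/
abbrev PNInstance : Type := (PNSystem × List ℕ) × (PNSystem × List ℕ)

/-- The decision problem PN ∼ PN: the two expressions are processes (markings) of the respective
systems, and they are bisimilar in the disjoint union of the two transition systems. -/
def PNBisimilarity (I : PNInstance) : Prop :=
  I.1.1.IsMarking (I.1.2 : Multiset ℕ) ∧ I.2.1.IsMarking (I.2.2 : Multiset ℕ) ∧
    (I.1.1.toLTS.disjointUnion I.2.1.toLTS).Bisimilar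
      (Sum.inl (I.1.2 : Multiset ℕ)) (Sum.inr (I.2.2 : Multiset ℕ))

/-! ### The class `Π⁰₁` -/

/-- `p a ↔ ∀ n, R a n` for some decidable relation `R`. -/
def IsPi01 {α : Type} [Primcodable α] (p : α → Prop) : Prop :=
  ∃ R : α × ℕ → Prop, ComputablePred R ∧ ∀ a, p a ↔ ∀ n, R (a, n)

/-- `Π⁰₁`-completeness with respect to computable many-one reductions. -/
def IsPi01Complete {α : Type} [Primcodable α] (p : α → Prop) : Prop :=
  IsPi01 p ∧ ∀ q : ℕ → Prop, IsPi01 q → ManyOneReducible q p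

/-! ### Minsky counter machines -/

/-- The two instruction forms (instruction labels and counters are numbered from `0`). -/
inductive Instr : Type where
  /-- `c_j := c_j + 1; goto k` -/
  | inc (j k : ℕ) : Instr
  /-- `if c_j = 0 then goto k else (c_j := c_j - 1; goto l)` -/
  | test (j k l : ℕ) : Instr

/-- A machine with counters `c_0, …, c_{numCounters - 1}`, the instructions of `program` at the
labels `0, …, program.length - 1`, and the instruction `halt` at the label `program.length`. -/
structure CounterMachine : Type where
  numCounters : ℕ
  program : List Instr

def Instr.equivSum : Instr ≃ (ℕ × ℕ) ⊕ (ℕ × ℕ × ℕ) where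
  toFun
    | .inc j k => Sum.inl (j, k)
    | .test j k l => Sum.inr (j, k, l)
  invFun
    | Sum.inl (j, k) => .inc j k
    | Sum.inr (j, k, l) => .test j k l
  left_inv x := by cases x <;> rfl
  right_inv x := by rcases x with ⟨j, k⟩ | ⟨j, k, l⟩ <;> rfl

instance : Primcodable Instr := Primcodable.ofEquiv _ Instr.equivSum

def CounterMachine.equivProd : CounterMachine ≃ ℕ × List Instr where
  toFun M := (M.numCounters, M.program)
  invFun x := ⟨x.1, x.2⟩
  left_inv _ := rfl
  right_inv _ := rfl

instance : Primcodable CounterMachine := Primcodable.ofEquiv _ CounterMachine.equivProd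

/-- The counter of the instruction is among the `m` counters and its targets are among the
`n` labels `0, …, n - 1`. -/
def Instr.WellFormed (m n : ℕ) : Instr → Prop
  | .inc j k => j < m ∧ k < n
  | .test j k l => j < m ∧ k < n ∧ l < n

namespace CounterMachine

def WellFormed (M : CounterMachine) : Prop :=
  ∀ ins ∈ M.program, ins.WellFormed M.numCounters (M.program.length + 1)

/-- The successor configuration; a configuration is a label with the counter values. -/
def next (M : CounterMachine) (x : ℕ × (ℕ → ℕ)) : Option (ℕ × (ℕ → ℕ)) :=
  match M.program[x.1]? with
  | none => none
  | some (.inc j k) => some (k, Function.update x.2 j (x.2 j + 1))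
  | some (.test j k l) =>
      if x.2 j = 0 then some (k, x.2) else some (l, Function.update x.2 j (x.2 j - 1))

/-- `M`, started at its first instruction with all counters `0`, reaches `halt`. -/
def Halts (M : CounterMachine) : Prop :=
  ∃ c : ℕ → ℕ, Relation.ReflTransGen (fun x y => M.next x = some y)
    (0, fun _ => 0) (M.program.length, c)

end CounterMachine

/-! ### The Petri net of a counter machine -/

namespace CounterNet

/-- The place of counter `j`. -/
def C (j : ℕ) : ℕ := 3 * j
/-- The control place of label `i`. -/
def Q (i : ℕ) : ℕ := 3 * i + 1
/-- The copy of the control place of label `i`. -/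
def Q' (i : ℕ) : ℕ := 3 * i + 2

def inc : ℕ := 0
def dec : ℕ := 1
def zer : ℕ := 2
def hlt : ℕ := 3

/-- The rules for the instruction at label `i`. -/
def instrRules (i : ℕ) : Instr → List PNRule
  | .inc j k =>
    [([Q i], inc, [Q k, C j]),
     ([Q' i], inc, [Q' k, C j])]
  | .test j k l =>
    [([Q i, C j], dec, [Q l]),
     ([Q' i, C j], dec, [Q' l]),
     ([Q i], zer, [Q k]),
     ([Q i, C j], zer, [Q' k, C j]),
     ([Q' i, C j], zer, [Q k, C j]),
     ([Q' i], zer, [Q' k])]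

/-- The Petri net of `M`. -/
def net (M : CounterMachine) : PNSystem :=
  ([Q M.program.length], hlt, []) ::
    M.program.zipIdx.flatMap fun p => instrRules p.2 p.1

/-- The instance of PN ∼ PN that asks whether the markings with one token in the first control
place, respectively in its copy, are bisimilar. -/
def bisimInstance (M : CounterMachine) : PNInstance :=
  ((net M, [Q 0]), (net M, [Q' 0]))

end CounterNet

/-! Defender's forcing: the two copies of the net simulate the machine in lockstep, and a run of `M`
is a play of the bisimulation game. The attacker follows the true run. An honest move has only one
answer, since a `zer` at an empty counter does not enable the switching rule. If the run halts, the
unprimed copy can fire `hlt` and the primed one cannot, so the start markings are not bisimilar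
(`not_rel_of_haltsFrom`). If the attacker fires `zer` at a nonempty counter, the defender picks
between the plain and the switching rule so that both sides reach the same marking. Hence equality
together with the divergent pairs of copies is a bisimulation (`isBisimulation_divergenceRel`).

Hardness: the complement of a Π⁰₁ predicate has the form `∃ k, h a k = 0` with `h` primitive
recursive. Primitive recursive functions are computed by terminating while programs over counters
(`computes_of_primrec'`), and these compile to counter machines. A machine that loads `a` and
searches for `k` diverges exactly when the predicate holds at `a` (`IsPi01.exists_machine`).

Membership: nets are finitely branching, so each non-bisimilar pair of markings has a finite
refutation, and checking a refutation is primitive recursive (`bisimilar_iff_forall_isRefutation`).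
Undecidability follows by applying completeness to the non-halting problem. -/

namespace LTS

variable {A : Type}

/-- Transitions of the union stay within their component, so a bisimulation can be cut down to its
pairs with one state on each side. -/
theorem disjointUnion_bisimilar_iff {T U : LTS A} {s : T.State} {u : U.State} :
    (T.disjointUnion U).Bisimilar (Sum.inl s) (Sum.inr u) ↔
      ∃ R : T.State → U.State → Prop,
        (∀ s u, R s u → ∀ a,
          (∀ s', T.Tr s a s' → ∃ u', U.Tr u a u' ∧ R s' u') ∧
          (∀ u', U.Tr u a u' → ∃ s', T.Tr s a s' ∧ R s' u')) ∧ R s u := by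
  constructor
  · rintro ⟨R, hR, h⟩
    refine ⟨fun s u => R (Sum.inl s) (Sum.inr u), fun s u hsu a =>
      ⟨fun s' hs => ?_, fun u' hu => ?_⟩, h⟩
    · obtain ⟨t', ht, hr⟩ := (hR _ _ hsu a).1 (Sum.inl s') hs
      rcases t' with t' | t'
      · exact ht.elim
      · exact ⟨t', ht, hr⟩
    · obtain ⟨t', ht, hr⟩ := (hR _ _ hsu a).2 (Sum.inr u') hu
      rcases t' with t' | t'
      · exact ⟨t', ht, hr⟩
      · exact ht.elim
  · rintro ⟨R, hR, h⟩
    refine ⟨fun x y => ∃ s u, x = Sum.inl s ∧ y = Sum.inr u ∧ R s u, ?_, s, u, rfl, rfl, h⟩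
    rintro _ _ ⟨s, u, rfl, rfl, hsu⟩ a
    refine ⟨fun x hx => ?_, fun x hx => ?_⟩
    · rcases x with s' | u'
      · obtain ⟨u', hu, hr⟩ := (hR s u hsu a).1 s' hx
        exact ⟨Sum.inr u', hu, s', u', rfl, rfl, hr⟩
      · exact hx.elim
    · rcases x with s' | u'
      · exact hx.elim
      · obtain ⟨s', hs, hr⟩ := (hR s u hsu a).2 u' hx
        exact ⟨Sum.inl s', hs, s', u', rfl, rfl, hr⟩

theorem disjointUnion_self_bisimilar_iff {T : LTS A} {s t : T.State} :
    (T.disjointUnion T).Bisimilar (Sum.inl s) (Sum.inr t) ↔ T.Bisimilar s t :=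
  disjointUnion_bisimilar_iff

end LTS

/-! ### Transitions of the net from a configuration -/

namespace CounterNet

/-- The control place of label `i`, or its copy. -/
def control (b : Bool) (i : ℕ) : ℕ := if b then Q' i else Q i

/-- The marking with one token in a control place and counter values given by `c`. -/
def config (b : Bool) (i : ℕ) (c : Multiset ℕ) : Multiset ℕ := control b i ::ₘ c.map C

theorem control_inj {b b' : Bool} {i i' : ℕ} : control b i = control b' i' ↔ b = b' ∧ i = i' := by
  cases b <;> cases b' <;> simp [control, Q, Q'] <;> omega

theorem control_ne_C (b : Bool) (i j : ℕ) : control b i ≠ C j := by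
  cases b <;> simp [control, Q, Q', C] <;> omega

theorem C_injective : Function.Injective C := fun i j h => by
  simp only [C] at h; omega

/-- A configuration has exactly one control token, so a rule that consumes a control token
determines the copy, the label and the remaining marking. -/
theorem control_add_eq_config {b b' : Bool} {i i' : ℕ} {c γ : Multiset ℕ} :
    config b i c = ([control b' i'] : Multiset ℕ) + γ ↔ b' = b ∧ i' = i ∧ γ = c.map C := by
  constructor
  · intro h
    have hm : control b' i' ∈ config b i c := by rw [h]; simp
    rcases Multiset.mem_cons.1 hm with hm | hm
    · obtain ⟨rfl, rfl⟩ := control_inj.1 hm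
      refine ⟨rfl, rfl, ?_⟩
      rw [Multiset.coe_singleton, Multiset.singleton_add] at h
      exact ((Multiset.cons_inj_right _).1 h).symm
    · obtain ⟨j, -, hj⟩ := Multiset.mem_map.1 hm
      exact (control_ne_C _ _ _ hj.symm).elim
  · rintro ⟨rfl, rfl, rfl⟩
    simp [config]

theorem control_C_add_eq_config {b b' : Bool} {i i' j : ℕ} {c γ : Multiset ℕ} :
    config b i c = ([control b' i', C j] : Multiset ℕ) + γ ↔
      b' = b ∧ i' = i ∧ j ∈ c ∧ γ = (c.erase j).map C := by
  have e : (([control b' i', C j] : List ℕ) : Multiset ℕ) + γ =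
      (([control b' i'] : List ℕ) : Multiset ℕ) + (C j ::ₘ γ) := by
    rw [← Multiset.cons_coe, Multiset.coe_singleton, Multiset.coe_singleton, Multiset.cons_add,
      Multiset.singleton_add, Multiset.singleton_add]
  rw [e, control_add_eq_config]
  refine and_congr_right fun _ => and_congr_right fun _ => ?_
  constructor
  · intro h
    have hj : j ∈ c := by
      have : C j ∈ c.map C := by rw [← h]; simp
      obtain ⟨j', hj', e⟩ := Multiset.mem_map.1 this
      exact C_injective e ▸ hj'
    refine ⟨hj, ?_⟩
    rw [← Multiset.cons_erase hj, Multiset.map_cons] at h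
    exact (Multiset.cons_inj_right _).1 h
  · rintro ⟨hj, rfl⟩
    rw [← Multiset.map_cons, Multiset.cons_erase hj]

theorem mem_instrRules_inc {i j k : ℕ} {r : PNRule} :
    r ∈ instrRules i (.inc j k) ↔ ∃ b, r = ([control b i], inc, [control b k, C j]) := by
  simp [instrRules, control]

theorem mem_instrRules_test {i j k l : ℕ} {r : PNRule} :
    r ∈ instrRules i (.test j k l) ↔ ∃ b,
      r = ([control b i, C j], dec, [control b l]) ∨ r = ([control b i], zer, [control b k]) ∨
      r = ([control b i, C j], zer, [control (!b) k, C j]) := by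
  simp only [instrRules, control, List.mem_cons, List.not_mem_nil, or_false, Bool.exists_bool]
  simp
  tauto

theorem mem_net {M : CounterMachine} {r : PNRule} :
    r ∈ net M ↔ r = ([control false M.program.length], hlt, []) ∨
      ∃ i ins, M.program[i]? = some ins ∧ r ∈ instrRules i ins := by
  simp only [net, List.mem_cons, List.mem_flatMap, Prod.exists, List.mem_zipIdx_iff_getElem?]
  refine or_congr Iff.rfl ⟨?_, ?_⟩
  · rintro ⟨ins, i, h⟩; exact ⟨i, ins, h⟩
  · rintro ⟨ins, i, h⟩; exact ⟨i, ins, h⟩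

theorem coe_control_C_add_erase {b : Bool} {k j : ℕ} {c : Multiset ℕ} (hj : j ∈ c) :
    (([control b k, C j] : List ℕ) : Multiset ℕ) + (c.erase j).map C = config b k c :=
  (control_C_add_eq_config.2 ⟨rfl, rfl, hj, rfl⟩).symm

theorem coe_control_add {b : Bool} {k : ℕ} {c : Multiset ℕ} :
    (([control b k] : List ℕ) : Multiset ℕ) + c.map C = config b k c :=
  (control_add_eq_config.2 ⟨rfl, rfl, rfl⟩).symm

theorem coe_control_C_add {b : Bool} {k j : ℕ} {c : Multiset ℕ} :
    (([control b k, C j] : List ℕ) : Multiset ℕ) + c.map C = config b k (j ::ₘ c) := by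
  rw [← coe_control_C_add_erase (Multiset.mem_cons_self j c), Multiset.erase_cons_head]

variable {M : CounterMachine} {b : Bool} {i j k l a : ℕ} {c m : Multiset ℕ}

/-- The full list of moves available to either player, uniform in the two copies except that only
the unprimed one can fire `hlt`. -/
theorem fires_config_iff :
    (net M).Fires (config b i c) a m ↔
      (a = hlt ∧ b = false ∧ i = M.program.length ∧ m = c.map C) ∨
      (∃ j k, M.program[i]? = some (.inc j k) ∧ a = inc ∧ m = config b k (j ::ₘ c)) ∨
      (∃ j k l, M.program[i]? = some (.test j k l) ∧
        ((a = dec ∧ j ∈ c ∧ m = config b l (c.erase j)) ∨ (a = zer ∧ m = config b k c) ∨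
          (a = zer ∧ j ∈ c ∧ m = config (!b) k c))) := by
  constructor
  · rintro ⟨r, hr, γ, h1, rfl, rfl⟩
    rcases mem_net.1 hr with rfl | ⟨i', ins, hi, hr⟩
    · obtain ⟨rfl, rfl, rfl⟩ := control_add_eq_config.1 h1
      left; simp
    · right
      rcases ins with ⟨j, k⟩ | ⟨j, k, l⟩
      · obtain ⟨b', rfl⟩ := mem_instrRules_inc.1 hr
        obtain ⟨rfl, rfl, rfl⟩ := control_add_eq_config.1 h1
        exact Or.inl ⟨j, k, hi, rfl, coe_control_C_add⟩
      · right
        obtain ⟨b', rfl | rfl | rfl⟩ := mem_instrRules_test.1 hr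
        · obtain ⟨rfl, rfl, hj, rfl⟩ := control_C_add_eq_config.1 h1
          exact ⟨j, k, l, hi, Or.inl ⟨rfl, hj, coe_control_add⟩⟩
        · obtain ⟨rfl, rfl, rfl⟩ := control_add_eq_config.1 h1
          exact ⟨j, k, l, hi, Or.inr (Or.inl ⟨rfl, coe_control_add⟩)⟩
        · obtain ⟨rfl, rfl, hj, rfl⟩ := control_C_add_eq_config.1 h1
          exact ⟨j, k, l, hi, Or.inr (Or.inr ⟨rfl, hj, coe_control_C_add_erase hj⟩)⟩
  · rintro (⟨rfl, rfl, rfl, rfl⟩ | ⟨j, k, hi, rfl, rfl⟩ |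
      ⟨j, k, l, hi, ⟨rfl, hj, rfl⟩ | ⟨rfl, rfl⟩ | ⟨rfl, hj, rfl⟩⟩)
    · exact ⟨_, mem_net.2 (Or.inl rfl), _, coe_control_add.symm, rfl, by simp⟩
    · exact ⟨_, mem_net.2 (Or.inr ⟨_, _, hi, mem_instrRules_inc.2 ⟨b, rfl⟩⟩), _,
        coe_control_add.symm, rfl, coe_control_C_add.symm⟩
    · exact ⟨_, mem_net.2 (Or.inr ⟨_, _, hi, mem_instrRules_test.2 ⟨b, Or.inl rfl⟩⟩), _,
        (coe_control_C_add_erase hj).symm, rfl, coe_control_add.symm⟩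
    · exact ⟨_, mem_net.2 (Or.inr ⟨_, _, hi, mem_instrRules_test.2 ⟨b, Or.inr (Or.inl rfl)⟩⟩), _,
        coe_control_add.symm, rfl, coe_control_add.symm⟩
    · exact ⟨_, mem_net.2 (Or.inr ⟨_, _, hi, mem_instrRules_test.2 ⟨b, Or.inr (Or.inr rfl)⟩⟩), _,
        (coe_control_C_add_erase hj).symm, rfl, (coe_control_C_add_erase hj).symm⟩

theorem fires_config_inc_iff (hi : M.program[i]? = some (.inc j k)) :
    (net M).Fires (config b i c) a m ↔ a = inc ∧ m = config b k (j ::ₘ c) := by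
  have hne : i ≠ M.program.length := by rintro rfl; simp at hi
  simp [fires_config_iff, hi, hne]

theorem fires_config_test_iff (hi : M.program[i]? = some (.test j k l)) :
    (net M).Fires (config b i c) a m ↔
      (a = dec ∧ j ∈ c ∧ m = config b l (c.erase j)) ∨ (a = zer ∧ m = config b k c) ∨
        (a = zer ∧ j ∈ c ∧ m = config (!b) k c) := by
  have hne : i ≠ M.program.length := by rintro rfl; simp at hi
  simp [fires_config_iff, hi, hne]

theorem fires_config_none_iff (hi : M.program[i]? = none) :
    (net M).Fires (config b i c) a m ↔
      a = hlt ∧ b = false ∧ i = M.program.length ∧ m = c.map C := by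
  simp [fires_config_iff, hi]

end CounterNet

/-! ### Machine steps with counter values given by multisets -/

namespace CounterMachine

variable {M : CounterMachine} {i j k l : ℕ}

theorem next_inc {c : Multiset ℕ} (hi : M.program[i]? = some (.inc j k)) :
    M.next (i, fun x => c.count x) = some (k, fun x => (j ::ₘ c).count x) := by
  simp only [next, hi, Option.some.injEq, Prod.mk.injEq, true_and]
  funext x
  by_cases h : x = j
  · subst h; simp
  · simp [h]

theorem next_test_zero {c : Multiset ℕ} (hi : M.program[i]? = some (.test j k l)) (hj : j ∉ c) :
    M.next (i, fun x => c.count x) = some (k, fun x => c.count x) := by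
  simp [next, hi, hj]

theorem next_test_succ {c : Multiset ℕ} (hi : M.program[i]? = some (.test j k l)) (hj : j ∈ c) :
    M.next (i, fun x => c.count x) = some (l, fun x => (c.erase j).count x) := by
  have h0 : c.count j ≠ 0 := by simpa using hj
  simp only [next, hi, h0, if_false, Option.some.injEq, Prod.mk.injEq, true_and]
  funext x
  by_cases h : x = j
  · subst h; simp
  · simp [h]

/-- `M` reaches `halt` from the configuration `x`. -/
def HaltsFrom (M : CounterMachine) (x : ℕ × (ℕ → ℕ)) : Prop :=
  ∃ c : ℕ → ℕ, Relation.ReflTransGen (fun x y => M.next x = some y) x (M.program.length, c)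

theorem HaltsFrom.of_next {x y : ℕ × (ℕ → ℕ)} (hxy : M.next x = some y) (h : M.HaltsFrom y) :
    M.HaltsFrom x :=
  let ⟨c, hc⟩ := h
  ⟨c, .head hxy hc⟩

end CounterMachine

/-! ### Bisimilarity of the two copies and divergence -/

namespace CounterNet

open CounterMachine

variable {M : CounterMachine}

/-- Induction backwards along the halting run. The unprimed side plays the step of `M`. The primed
side has one reply, because a true zero test leaves no token for the switching rule. At the halting
label the `hlt` move has no reply. -/
theorem not_rel_of_haltsFrom {R : Multiset ℕ → Multiset ℕ → Prop}
    (hR : (net M).toLTS.IsBisimulation R) {x : ℕ × (ℕ → ℕ)} (hx : M.HaltsFrom x) :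
    ∀ c : Multiset ℕ, (x.2 = fun j => c.count j) →
      ¬ R (config false x.1 c) (config true x.1 c) := by
  obtain ⟨d, hd⟩ := hx
  induction hd using Relation.ReflTransGen.head_induction_on with
  | refl =>
    intro c _ h
    obtain ⟨m, hm, -⟩ := (hR _ _ h hlt).1 (c.map C)
      ((fires_config_none_iff (by simp)).2 ⟨rfl, rfl, rfl, rfl⟩)
    have := (fires_config_none_iff (M := M) (by simp)).1 hm
    simp at this
  | @head x y hxy _ ih =>
    obtain ⟨i, v⟩ := x
    rintro c hc h
    change v = _ at hc
    subst hc
    change R (config false i c) (config true i c) at h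
    rcases hi : M.program[i]? with _ | ins
    · simp [next, hi] at hxy
    rcases ins with ⟨j, k⟩ | ⟨j, k, l⟩
    · rw [next_inc hi] at hxy
      obtain rfl := Option.some.inj hxy
      obtain ⟨m, hm, hr⟩ := (hR _ _ h inc).1 _ ((fires_config_inc_iff hi).2 ⟨rfl, rfl⟩)
      obtain ⟨-, rfl⟩ := (fires_config_inc_iff hi).1 hm
      exact ih _ rfl hr
    · by_cases hj : j ∈ c
      · rw [next_test_succ hi hj] at hxy
        obtain rfl := Option.some.inj hxy
        obtain ⟨m, hm, hr⟩ := (hR _ _ h dec).1 _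
          ((fires_config_test_iff hi).2 (Or.inl ⟨rfl, hj, rfl⟩))
        rcases (fires_config_test_iff hi).1 hm with ⟨-, -, rfl⟩ | ⟨h, -⟩ | ⟨h, -⟩
        · exact ih _ rfl hr
        · simp [dec, zer] at h
        · simp [dec, zer] at h
      · rw [next_test_zero hi hj] at hxy
        obtain rfl := Option.some.inj hxy
        obtain ⟨m, hm, hr⟩ := (hR _ _ h zer).1 _
          ((fires_config_test_iff hi).2 (Or.inr (Or.inl ⟨rfl, rfl⟩)))
        rcases (fires_config_test_iff hi).1 hm with ⟨h, -⟩ | ⟨-, rfl⟩ | ⟨-, h, -⟩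
        · simp [dec, zer] at h
        · exact ih _ rfl hr
        · exact (hj h).elim

/-- Equality together with the pairs of copies of a configuration from which `M` diverges. -/
def DivergenceRel (M : CounterMachine) (m m' : Multiset ℕ) : Prop :=
  m = m' ∨ ∃ b i, ∃ c : Multiset ℕ, m = config b i c ∧ m' = config (!b) i c ∧
    ¬ M.HaltsFrom (i, fun x => c.count x)

theorem DivergenceRel.symm {m m' : Multiset ℕ} (h : DivergenceRel M m m') :
    DivergenceRel M m' m := by
  rcases h with rfl | ⟨b, i, c, rfl, rfl, h⟩
  · exact Or.inl rfl
  · exact Or.inr ⟨!b, i, c, rfl, by simp, h⟩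

/-- Moves that agree with the machine are copied and keep divergence. A `zer` with a token on the
tested counter is answered by the other kind of `zer` rule, which yields equal markings. A `hlt`
move would need the halting label, which divergence excludes. -/
theorem DivergenceRel.exists_fires {m₁ m₂ m₁' : Multiset ℕ} {a : ℕ} (h : DivergenceRel M m₁ m₂)
    (hf : (net M).Fires m₁ a m₁') :
    ∃ m₂', (net M).Fires m₂ a m₂' ∧ DivergenceRel M m₁' m₂' := by
  rcases h with rfl | ⟨b, i, c, rfl, rfl, h⟩
  · exact ⟨m₁', hf, Or.inl rfl⟩
  rcases hi : M.program[i]? with _ | ins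
  · obtain ⟨-, -, rfl, -⟩ := (fires_config_none_iff hi).1 hf
    exact (h ⟨_, .refl⟩).elim
  rcases ins with ⟨j, k⟩ | ⟨j, k, l⟩
  · obtain ⟨rfl, rfl⟩ := (fires_config_inc_iff hi).1 hf
    exact ⟨_, (fires_config_inc_iff hi).2 ⟨rfl, rfl⟩,
      Or.inr ⟨b, k, _, rfl, rfl, fun h' => h (h'.of_next (next_inc hi))⟩⟩
  · rcases (fires_config_test_iff hi).1 hf with ⟨rfl, hj, rfl⟩ | ⟨rfl, rfl⟩ | ⟨rfl, hj, rfl⟩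
    · exact ⟨_, (fires_config_test_iff hi).2 (Or.inl ⟨rfl, hj, rfl⟩),
        Or.inr ⟨b, l, _, rfl, rfl, fun h' => h (h'.of_next (next_test_succ hi hj))⟩⟩
    · by_cases hj : j ∈ c
      · exact ⟨_, (fires_config_test_iff hi).2 (Or.inr (Or.inr ⟨rfl, hj, rfl⟩)),
          Or.inl (by simp)⟩
      · exact ⟨_, (fires_config_test_iff hi).2 (Or.inr (Or.inl ⟨rfl, rfl⟩)),
          Or.inr ⟨b, k, _, rfl, rfl, fun h' => h (h'.of_next (next_test_zero hi hj))⟩⟩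
    · exact ⟨_, (fires_config_test_iff hi).2 (Or.inr (Or.inl ⟨rfl, rfl⟩)), Or.inl rfl⟩

theorem isBisimulation_divergenceRel (M : CounterMachine) :
    (net M).toLTS.IsBisimulation (DivergenceRel M) := fun _ _ hst _ =>
  ⟨fun _ hs => hst.exists_fires hs, fun _ ht =>
    let ⟨s', hs, hr⟩ := hst.symm.exists_fires ht
    ⟨s', hs, hr.symm⟩⟩

theorem bisimilar_iff_not_halts (M : CounterMachine) :
    (net M).toLTS.Bisimilar ({Q 0} : Multiset ℕ) ({Q' 0} : Multiset ℕ) ↔ ¬ M.Halts := by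
  constructor
  · rintro ⟨R, hR, h⟩ hM
    exact not_rel_of_haltsFrom hR (x := (0, fun _ => 0)) hM 0 (by simp) h
  · intro hM
    refine ⟨_, isBisimulation_divergenceRel M, Or.inr ⟨false, 0, 0, rfl, rfl, ?_⟩⟩
    simpa [HaltsFrom, Halts] using hM

/-- With an empty program label `0` is already `halt`, and then `Q' 0` occurs in no rule. Divergence
excludes this case. -/
theorem isPlace_control_zero (hM : ¬ M.Halts) (b : Bool) : (net M).IsPlace (control b 0) := by
  rcases hi : M.program[0]? with _ | ins
  · refine (hM ⟨fun _ => 0, ?_⟩).elim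
    rw [Nat.eq_zero_of_le_zero (List.getElem?_eq_none_iff.1 hi)]
  · rcases ins with ⟨j, k⟩ | ⟨j, k, l⟩
    · exact ⟨_, mem_net.2 (Or.inr ⟨_, _, hi, mem_instrRules_inc.2 ⟨b, rfl⟩⟩), Or.inl (by simp)⟩
    · exact ⟨_, mem_net.2 (Or.inr ⟨_, _, hi, mem_instrRules_test.2 ⟨b, Or.inl rfl⟩⟩),
        Or.inl (by simp)⟩

theorem pnBisimilarity_bisimInstance_iff (M : CounterMachine) :
    PNBisimilarity (bisimInstance M) ↔ ¬ M.Halts := by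
  have key := (LTS.disjointUnion_self_bisimilar_iff (T := (net M).toLTS)).trans
    (bisimilar_iff_not_halts M)
  refine ⟨fun h => key.1 h.2.2, fun h => ⟨?_, ?_, key.2 h⟩⟩
  · intro x hx
    obtain rfl : x = Q 0 := by simpa [bisimInstance] using hx
    exact isPlace_control_zero h false
  · intro x hx
    obtain rfl : x = Q' 0 := by simpa [bisimInstance] using hx
    exact isPlace_control_zero h true

end CounterNet

/-! ### While programs over counters -/

/-- While programs: `loop j c` is `while c_j ≠ 0 do (c_j := c_j - 1; c)`. -/
inductive Cmd : Type where
  | inc (j : ℕ) : Cmd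
  | clear (j : ℕ) : Cmd
  | seq (c d : Cmd) : Cmd
  | loop (j : ℕ) (c : Cmd) : Cmd

namespace Cmd

open Function (update)

/-- Big-step semantics of while programs. -/
inductive Eval : Cmd → (ℕ → ℕ) → (ℕ → ℕ) → Prop
  | inc (j s) : Eval (inc j) s (update s j (s j + 1))
  | clear (j s) : Eval (clear j) s (update s j 0)
  | seq {c d s t u} : Eval c s t → Eval d t u → Eval (seq c d) s u
  | loop_zero {j c s} : s j = 0 → Eval (loop j c) s s
  | loop_succ {j c s t u} : s j ≠ 0 → Eval c (update s j (s j - 1)) t → Eval (loop j c) t u →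
      Eval (loop j c) s u

/-- Loop rule for total correctness: the invariant is indexed by the loop counter, which the body
must leave at its decremented value, so the loop terminates. -/
theorem exists_eval_loop {j : ℕ} {c : Cmd} (I : ℕ → (ℕ → ℕ) → Prop) (hj : ∀ n s, I n s → s j = n)
    (hc : ∀ n s, I (n + 1) s → ∃ t, c.Eval (update s j n) t ∧ I n t) :
    ∀ n s, I n s → ∃ t, (loop j c).Eval s t ∧ I 0 t
  | 0, s, h => ⟨s, .loop_zero (hj _ _ h), h⟩
  | n + 1, s, h => by
    obtain ⟨t, ht, hI⟩ := hc n s h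
    obtain ⟨u, hu, hI⟩ := exists_eval_loop I hj hc n t hI
    have e := hj _ _ h
    exact ⟨u, .loop_succ (by omega) (by rwa [e]) hu, hI⟩

/-- Move the value of `x` to `y`. -/
def move (x y : ℕ) : Cmd := seq (clear y) (loop x (inc y))

theorem exists_eval_move {x y : ℕ} (hxy : x ≠ y) (s : ℕ → ℕ) :
    ∃ t, (move x y).Eval s t ∧ t y = s x ∧ ∀ r, r ≠ x → r ≠ y → t r = s r := by
  obtain ⟨t, ht, -, h1, h2⟩ := exists_eval_loop (j := x) (c := inc y)
    (fun n t => t x = n ∧ t y + n = s x ∧ ∀ r, r ≠ x → r ≠ y → t r = s r) (fun _ _ h => h.1)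
    (fun n t ⟨h0, h1, h2⟩ => ⟨_, .inc _ _, by simp [hxy], by simp [hxy.symm]; omega,
      fun r hr hr' => by simp [hr, hr', h2]⟩)
    (s x) (update s y 0) ⟨by simp [hxy], by simp, fun r _ hr => by simp [hr]⟩
  exact ⟨t, .seq (.clear _ _) ht, by omega, h2⟩

/-- Copy the value of `x` to `y`, using `z` as scratch space. -/
def copy (x y z : ℕ) : Cmd :=
  seq (clear y) (seq (clear z) (seq (loop x (seq (inc y) (inc z))) (loop z (inc x))))

theorem exists_eval_copy {x y z : ℕ} (hxy : x ≠ y) (hxz : x ≠ z) (hyz : y ≠ z) (s : ℕ → ℕ) :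
    ∃ t, (copy x y z).Eval s t ∧ t y = s x ∧ ∀ r, r ≠ y → r ≠ z → t r = s r := by
  obtain ⟨t, ht, h0, h1, h2, h3⟩ := exists_eval_loop (j := x) (c := seq (inc y) (inc z))
    (fun n t => t x = n ∧ t y + n = s x ∧ t z + n = s x ∧
      ∀ r, r ≠ x → r ≠ y → r ≠ z → t r = s r) (fun _ _ h => h.1)
    (fun n t ⟨h0, h1, h2, h3⟩ => ⟨_, .seq (.inc _ _) (.inc _ _), by simp [hxy, hxz],
      by simp [hxy.symm, hyz]; omega, by simp [hxz.symm, hyz.symm]; omega,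
      fun r hr hr' hr'' => by simp [hr, hr', hr'', h3]⟩)
    (s x) (update (update s y 0) z 0) ⟨by simp [hxy, hxz], by simp [hyz], by simp,
      fun r _ hr hr' => by simp [hr, hr']⟩
  obtain ⟨u, hu, -, h4, h5, h6⟩ := exists_eval_loop (j := z) (c := inc x)
    (fun n u => u z = n ∧ u x + n = s x ∧ u y = s x ∧
      ∀ r, r ≠ x → r ≠ y → r ≠ z → u r = s r) (fun _ _ h => h.1)
    (fun n u ⟨h0, h1, h2, h3⟩ => ⟨_, .inc _ _, by simp [hxz.symm],
      by simp [hxz]; omega, by simp [hxy.symm, hyz, h2],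
      fun r hr hr' hr'' => by simp [hr, hr'', h3 r hr hr' hr'']⟩)
    (t z) t ⟨rfl, by omega, by omega, h3⟩
  refine ⟨u, .seq (.clear _ _) (.seq (.clear _ _) (.seq ht hu)), h5, fun r hr hr' => ?_⟩
  by_cases h : r = x
  · subst h; omega
  · exact h6 r h hr hr'

/-- For all choices of input counters below `N` there is a while program that leaves the value of
`f` in the counter `N` and keeps the counters below `N`. -/
def Computes {n : ℕ} (f : List.Vector ℕ n → ℕ) : Prop :=
  ∀ (N : ℕ) (ρ : Fin n → ℕ), (∀ i, ρ i < N) →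
    ∃ c : Cmd, ∀ s, ∃ t, c.Eval s t ∧ t N = f (.ofFn fun i => s (ρ i)) ∧ ∀ r < N, t r = s r

theorem computes_get {n : ℕ} (i : Fin n) : Computes fun v => v.get i := fun N ρ hρ =>
  ⟨copy (ρ i) N (N + 1), fun s => by
    have := hρ i
    obtain ⟨t, ht, h1, h2⟩ := exists_eval_copy (x := ρ i) (y := N) (z := N + 1)
      (by omega) (by omega) (by omega) s
    exact ⟨t, ht, by simp [h1], fun r hr => h2 r (by omega) (by omega)⟩⟩

/-- The values are computed one after another into `N`, `N + 1`, …; each program preserves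
everything below its own target, so the inputs and earlier results survive. -/
theorem Computes.exists_cmd_forall {m n : ℕ} {g : Fin n → List.Vector ℕ m → ℕ}
    (hg : ∀ i, Computes (g i)) {N : ℕ} {ρ : Fin m → ℕ} (hρ : ∀ i, ρ i < N) :
    ∀ k ≤ n, ∃ c : Cmd, ∀ s, ∃ t, c.Eval s t ∧
      (∀ i : Fin n, (i : ℕ) < k → t (N + i) = g i (.ofFn fun i => s (ρ i))) ∧
      ∀ r < N, t r = s r
  -- There is no empty command; clearing the scratch counter `N` serves as one.
  | 0, _ => ⟨clear N, fun s => ⟨_, .clear _ _, by simp, fun r hr => by simp [hr.ne]⟩⟩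
  | k + 1, hk => by
    obtain ⟨c, hc⟩ := exists_cmd_forall hg hρ k (by omega)
    obtain ⟨d, hd⟩ := hg ⟨k, hk⟩ (N + k) ρ fun i => (hρ i).trans_le (by omega)
    refine ⟨seq c d, fun s => ?_⟩
    obtain ⟨t, ht, h1, h2⟩ := hc s
    obtain ⟨u, hu, h3, h4⟩ := hd t
    refine ⟨u, .seq ht hu, fun i hi => ?_, fun r hr => (h4 r (by omega)).trans (h2 r hr)⟩
    rcases Nat.lt_succ_iff_lt_or_eq.1 hi with hi | hi
    · rw [h4 _ (by omega), h1 i hi]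
    · obtain rfl : i = ⟨k, hk⟩ := Fin.ext hi
      simp only [h3, h2 _ (hρ _)]

theorem Computes.comp {m n : ℕ} {f : List.Vector ℕ n → ℕ} {g : Fin n → List.Vector ℕ m → ℕ}
    (hf : Computes f) (hg : ∀ i, Computes (g i)) :
    Computes fun v => f (.ofFn fun i => g i v) := fun N ρ hρ => by
  obtain ⟨c, hc⟩ := Computes.exists_cmd_forall hg hρ n le_rfl
  -- The target is `N + n + 1` rather than `N + n`, so that it differs from `N` even for `n = 0`, as
  -- the final move requires.
  obtain ⟨d, hd⟩ := hf (N + n + 1) (fun i => N + i) fun i => by omega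
  refine ⟨seq c (seq d (move (N + n + 1) N)), fun s => ?_⟩
  obtain ⟨t, ht, h1, h2⟩ := hc s
  obtain ⟨u, hu, h3, h4⟩ := hd t
  obtain ⟨v, hv, h5, h6⟩ := exists_eval_move (x := N + n + 1) (y := N) (by omega) u
  refine ⟨v, .seq ht (.seq hu hv), ?_, fun r hr => ?_⟩
  · rw [h5, h3]
    simp only [h1 _ (Fin.is_lt _)]
  · rw [h6 r (by omega) (by omega), h4 r (by omega), h2 r hr]

theorem Computes.prec {n : ℕ} {f : List.Vector ℕ n → ℕ} {g : List.Vector ℕ (n + 2) → ℕ}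
    (hf : Computes f) (hg : Computes g) :
    Computes fun v : List.Vector ℕ (n + 1) =>
      v.head.rec (f v.tail) fun y IH => g (y ::ᵥ IH ::ᵥ v.tail) := fun N ρ hρ => by
  obtain ⟨c, hc⟩ := hf N (fun i => ρ i.succ) fun i => hρ _
  -- Layout: `N` holds the value computed so far, `N + 1` the recursion index, `N + 2` the number of
  -- rounds left, and `N + 3` the new value of `g` before it is moved to `N`.
  obtain ⟨d, hd⟩ := hg (N + 3) (Fin.cons (N + 1) (Fin.cons N fun i => ρ i.succ)) fun i => by
    refine Fin.cases ?_ (fun i => Fin.cases ?_ (fun i => ?_) i) i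
    · simp
    · simp
    · have := hρ i.succ
      simp; omega
  refine ⟨seq c (seq (clear (N + 1)) (seq (copy (ρ 0) (N + 2) (N + 3))
    (loop (N + 2) (seq d (seq (move (N + 3) N) (inc (N + 1))))))), fun s => ?_⟩
  have h0 := hρ 0
  let w : List.Vector ℕ n := .ofFn fun i => s (ρ i.succ)
  let F : ℕ → ℕ := fun k => k.rec (f w) fun y IH => g (y ::ᵥ IH ::ᵥ w)
  obtain ⟨t, ht, h1, h2⟩ := hc s
  obtain ⟨u, hu, h3, h4⟩ := exists_eval_copy (x := ρ 0) (y := N + 2) (z := N + 3)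
    (by omega) (by omega) (by omega) (update t (N + 1) 0)
  obtain ⟨v, hv, h5, h6, h7, h8⟩ := exists_eval_loop (j := N + 2)
    (c := seq d (seq (move (N + 3) N) (inc (N + 1))))
    (fun k v => v (N + 2) = k ∧ v (N + 1) + k = s (ρ 0) ∧ v N = F (v (N + 1)) ∧
      ∀ r < N, v r = s r) (fun _ _ h => h.1)
    (fun k v ⟨h5, h6, h7, h8⟩ => by
      obtain ⟨x, hx, h9, h10⟩ := hd (update v (N + 2) k)
      obtain ⟨y, hy, h11, h12⟩ := exists_eval_move (x := N + 3) (y := N) (by omega) x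
      have e1 : y (N + 1) = v (N + 1) := by
        rw [h12 _ (by omega) (by omega), h10 _ (by omega)]; simp
      refine ⟨_, .seq hx (.seq hy (.inc _ _)), ?_, ?_, ?_, fun r hr => ?_⟩
      · simp only [ne_eq, Nat.add_left_cancel_iff, OfNat.ofNat_ne_one, not_false_eq_true,
          Function.update_of_ne]
        rw [h12 _ (by omega) (by omega), h10 _ (by omega)]; simp
      · simp only [Function.update_self]; omega
      · rw [Function.update_of_ne (by omega), Function.update_self, h11, h9, e1]
        change g _ = g (v (N + 1) ::ᵥ F (v (N + 1)) ::ᵥ w)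
        congr 1
        have e : ∀ i : Fin n, update v (N + 2) k (ρ i.succ) = s (ρ i.succ) := fun i => by
          have := hρ i.succ
          rw [Function.update_of_ne (by omega), h8 _ this]
        simp [List.Vector.ofFn, e, h7, w]
      · rw [Function.update_of_ne (by omega), h12 _ (by omega) (by omega), h10 _ (by omega),
          Function.update_of_ne (by omega), h8 _ hr])
    (u (N + 2)) u ⟨rfl, by
      rw [h4 _ (by omega) (by omega), h3, Function.update_self, Function.update_of_ne (by omega),
        h2 _ h0, zero_add], by
      rw [h4 _ (by omega) (by omega), h4 _ (by omega) (by omega), Function.update_self,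
        Function.update_of_ne (by omega), h1]; rfl, fun r hr => by
      rw [h4 _ (by omega) (by omega), Function.update_of_ne (by omega), h2 _ hr]⟩
  refine ⟨v, .seq ht (.seq (.clear _ _) (.seq hu hv)), ?_, h8⟩
  rw [h7, show v (N + 1) = s (ρ 0) by omega]
  simp [F, w, List.Vector.ofFn]

theorem computes_of_primrec' {n : ℕ} {f : List.Vector ℕ n → ℕ} (hf : Nat.Primrec' f) :
    Computes f := by
  induction hf with
  | zero => exact fun N ρ _ => ⟨clear N, fun s => ⟨_, .clear _ _, by simp,
      fun r hr => by simp [hr.ne]⟩⟩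
  | succ =>
    intro N ρ hρ
    obtain ⟨c, hc⟩ := computes_get 0 N ρ hρ
    refine ⟨seq c (inc N), fun s => ?_⟩
    obtain ⟨t, ht, h1, h2⟩ := hc s
    exact ⟨_, .seq ht (.inc _ _), by simp [h1, List.Vector.ofFn],
      fun r hr => by simp [hr.ne, h2 r hr]⟩
  | get i => exact computes_get i
  | comp g _ _ hf hg => exact hf.comp hg
  | prec _ _ hf hg => exact hf.prec hg

/-! ### Compilation of while programs to counter machines -/

def length : Cmd → ℕ
  | inc _ => 1
  | clear _ => 1
  | seq c d => c.length + d.length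
  | loop _ c => c.length + 1

/-- The instructions for a while program that are to be placed at the labels from `b` on and
that leave to the label `e`. -/
def compile : Cmd → ℕ → ℕ → List Instr
  | inc j, _, e => [.inc j e]
  | clear j, b, e => [.test j e b]
  | seq c d, b, e => c.compile b (b + c.length) ++ d.compile (b + c.length) e
  | loop j c, b, e => .test j e (b + 1) :: c.compile (b + 1) b

@[simp]
theorem length_compile (c : Cmd) (b e : ℕ) : (c.compile b e).length = c.length := by
  induction c generalizing b e <;> simp [compile, length, *]

end Cmd

namespace CounterMachine

open Function (update)

variable {M : CounterMachine} {b e : ℕ}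

/-- The program of `M` contains the instructions `L` at the labels from `b` on. -/
def CodeAt (M : CounterMachine) (b : ℕ) (L : List Instr) : Prop :=
  ∀ i ins, L[i]? = some ins → M.program[b + i]? = some ins

theorem CodeAt.left {L L' : List Instr} (h : M.CodeAt b (L ++ L')) : M.CodeAt b L :=
  fun i ins hi => h i ins (by
    rw [List.getElem?_append_left (List.getElem?_eq_some_iff.1 hi).1, hi])

theorem CodeAt.right {L L' : List Instr} (h : M.CodeAt b (L ++ L')) :
    M.CodeAt (b + L.length) L' :=
  fun i ins hi => by
    rw [add_assoc]
    exact h _ ins (by rw [List.getElem?_append_right (by omega), Nat.add_sub_cancel_left, hi])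

theorem CodeAt.head {ins : Instr} {L : List Instr} (h : M.CodeAt b (ins :: L)) :
    M.program[b]? = some ins :=
  h 0 ins rfl

theorem CodeAt.tail {ins : Instr} {L : List Instr} (h : M.CodeAt b (ins :: L)) :
    M.CodeAt (b + 1) L :=
  CodeAt.right (L := [ins]) h

abbrev Reaches (M : CounterMachine) : ℕ × (ℕ → ℕ) → ℕ × (ℕ → ℕ) → Prop :=
  Relation.ReflTransGen fun x y => M.next x = some y

/-- Induction on the evaluation. The body of a loop is compiled so as to leave to the loop's own
test, so the same code serves for the remaining iterations. -/
theorem CodeAt.reaches {c : Cmd} {s t : ℕ → ℕ} (hst : c.Eval s t) {b e : ℕ}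
    (h : M.CodeAt b (c.compile b e)) : M.Reaches (b, s) (e, t) := by
  induction hst generalizing b e with
  | inc j s => exact .single (by simp [next, h.head])
  | clear j s =>
    generalize hn : s j = n
    -- The instruction for `clear` jumps back to itself until the counter is zero.
    induction n generalizing s with
    | zero =>
      rw [← hn, Function.update_eq_self]
      exact .single (by simp [next, h.head, hn])
    | succ n ih =>
      have := ih (update s j n) (by simp)
      rw [Function.update_idem] at this
      exact .head (by simp [next, h.head, hn]) this
  | seq _ _ ihc ihd =>
    refine (ihc h.left).trans (ihd ?_)
    simpa using h.right
  | loop_zero hj => exact .single (by simp [next, h.head, hj])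
  | @loop_succ j c s t u hj _ _ ihc ihl =>
    exact .head (b := (b + 1, update s j (s j - 1))) (by simp [next, h.head, hj])
      ((ihc h.tail).trans (ihl h))

/-- A set of configurations to which `M` always returns contains no halting configuration. -/
theorem not_reaches_of_recurrent {P : ℕ × (ℕ → ℕ) → Prop}
    (hP : ∀ x, P x → ∃ y z, M.next x = some y ∧ M.Reaches y z ∧ P z)
    {x z : ℕ × (ℕ → ℕ)} (hxz : M.Reaches x z) (hz : M.next z = none) : ¬ P x := by
  -- Since `next` is a function, the run to the halting configuration is the only run from `x`;
  -- hence `x` is accessible, and returning to `P` forever would contradict well-founded induction.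
  have acc : Acc (fun y x => M.next x = some y) x := by
    induction hxz using Relation.ReflTransGen.head_induction_on with
    | refl => exact ⟨_, fun y hy => by simp [hz] at hy⟩
    | @head x y hxy _ ih =>
      refine ⟨_, fun y' hy' => ?_⟩
      obtain rfl := Option.some.inj (hxy.symm.trans hy')
      exact ih
  have acc' := acc.transGen
  clear acc hxz
  induction acc' with
  | intro x _ ih =>
    intro hx
    obtain ⟨y, z', hxy, hyz, hz'⟩ := hP x hx
    exact ih z' (Relation.transGen_swap.2 (.head' hxy hyz)) hz'

end CounterMachine

/-! ### Reduction of `Π⁰₁` predicates to divergence of counter machines -/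

namespace Cmd

open Function (update)

/-- Instructions that set the counter `0` to `a` and leave to the label `a`. -/
def loadInstrs (a : ℕ) : List Instr := (List.range a).map fun i => .inc 0 (i + 1)

/-- If `c` computes `h (c_0, c_1)` in the counter `2`, this searches for a value of `c_1` at which
`h` vanishes. -/
def search (c : Cmd) : Cmd := seq c (loop 2 (seq (inc 1) c))

/-- A number of counters that suffices for a while program. -/
def numCounters : Cmd → ℕ
  | inc j => j + 1
  | clear j => j + 1
  | seq c d => max c.numCounters d.numCounters
  | loop j c => max (j + 1) c.numCounters

/-- The machine that sets the counter `0` to `a` and then executes `c`. -/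
def machine (c : Cmd) (a : ℕ) : CounterMachine :=
  ⟨max 1 c.numCounters, loadInstrs a ++ c.compile a (a + c.length)⟩

variable {c : Cmd} {a : ℕ}

theorem length_program_machine : (machine c a).program.length = a + c.length := by
  simp [machine, loadInstrs]

theorem codeAt_machine : (machine c a).CodeAt a (c.compile a (a + c.length)) := by
  have : (machine c a).CodeAt 0 (loadInstrs a ++ c.compile a (a + c.length)) :=
    fun i ins h => by simpa [machine] using h
  simpa [loadInstrs] using this.right

theorem reaches_load : (machine c a).Reaches (0, fun _ => 0) (a, update (fun _ => 0) 0 a) := by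
  have : ∀ k ≤ a, (machine c a).Reaches (0, fun _ => 0) (k, update (fun _ => 0) 0 k) := by
    intro k
    induction k with
    | zero => intro _; rw [Function.update_eq_self_iff.2 rfl]
    | succ k ih =>
      intro hk
      refine (ih (by omega)).tail ?_
      have : (machine c a).program[k]? = some (.inc 0 (k + 1)) := by
        simp only [machine]
        rw [List.getElem?_append_left (by simp [loadInstrs]; omega)]
        simp [loadInstrs, List.getElem?_range hk]
      simp [CounterMachine.next, this]
  exact this a le_rfl

theorem halts_machine_search_iff {h : ℕ → ℕ → ℕ}
    (hc : ∀ s, ∃ t, c.Eval s t ∧ t 2 = h (s 0) (s 1) ∧ ∀ r < 2, t r = s r) :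
    (machine c.search a).Halts ↔ ∃ k, h a k = 0 := by
  obtain ⟨s₀, hs₀, h₀⟩ : ∃ s₀, c.Eval (update (fun _ => 0) 0 a) s₀ ∧
      s₀ 0 = a ∧ s₀ 1 = 0 ∧ s₀ 2 = h (s₀ 0) (s₀ 1) := by
    obtain ⟨t, ht, h1, h2⟩ := hc (update (fun _ => 0) 0 a)
    exact ⟨t, ht, by simp [h2], by simp [h2], by simp [h1, h2]⟩
  have hbody : ∀ s : ℕ → ℕ, ∃ t, (seq (inc 1) c).Eval (update s 2 (s 2 - 1)) t ∧
      t 0 = s 0 ∧ t 1 = s 1 + 1 ∧ t 2 = h (t 0) (t 1) := by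
    intro s
    obtain ⟨t, ht, h1, h2⟩ := hc
      (update (update s 2 (s 2 - 1)) 1 (update s 2 (s 2 - 1) 1 + 1))
    exact ⟨t, .seq (.inc _ _) ht, by simp [h2], by simp [h2], by simp [h1, h2]⟩
  have hcode : (machine c.search a).CodeAt a (c.search.compile a (a + c.search.length)) :=
    codeAt_machine
  constructor
  · rintro ⟨d, hd⟩
    by_contra! hk
    have h1 : (machine c.search a).Reaches (a, update (fun _ => 0) 0 a) (a + c.length, s₀) :=
      hcode.left.reaches hs₀
    have hloop := hcode.right
    rw [length_compile] at hloop
    -- The recurrent set consists of the configurations that lead to the loop head with correct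
    -- data. It contains the start, and from the loop head one more iteration leads back to it
    -- because `h` never vanishes.
    refine CounterMachine.not_reaches_of_recurrent
      (P := fun x => ∃ y, (machine c.search a).Reaches x y ∧ y.1 = a + c.length ∧ y.2 0 = a ∧
        y.2 2 = h (y.2 0) (y.2 1)) ?_ hd
      (by simp [CounterMachine.next]) ⟨_, reaches_load.trans h1, rfl, h₀.1, h₀.2.2⟩
    rintro x ⟨⟨i, s⟩, hxs, rfl, hs0, hs2⟩
    simp only at hs0 hs2
    have hne : s 2 ≠ 0 := by rw [hs2, hs0]; exact hk _
    have hn : (machine c.search a).next (a + c.length, s) =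
        some (a + c.length + 1, update s 2 (s 2 - 1)) := by
      simp [CounterMachine.next, hloop.head, hne]
    obtain ⟨t, ht, ht0, -, ht2⟩ := hbody s
    have hr : (machine c.search a).Reaches _ _ := hloop.tail.reaches ht
    rcases hxs.cases_head with rfl | ⟨y, hxy, hy⟩
    · exact ⟨_, _, hn, hr, _, .refl, rfl, ht0.trans hs0, ht2⟩
    · exact ⟨y, _, hxy, (hy.tail hn).trans hr, _, .refl, rfl, ht0.trans hs0, ht2⟩
  · rintro ⟨k, hk⟩
    -- Here `n` is the distance from the current candidate in counter `1` to the known zero `k`; the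
    -- loop may stop earlier, at a smaller zero.
    have hsearch : ∀ n s, s 0 = a → s 1 + n = k → s 2 = h (s 0) (s 1) →
        ∃ t, (loop 2 (seq (inc 1) c)).Eval s t := by
      intro n
      induction n with
      | zero =>
        intro s h0 h1 h2
        refine ⟨s, .loop_zero ?_⟩
        rw [h2, h0, ← hk, ← h1, add_zero]
      | succ n ih =>
        intro s h0 h1 h2
        by_cases hz : s 2 = 0
        · exact ⟨s, .loop_zero hz⟩
        · obtain ⟨t, ht, ht0, ht1, ht2⟩ := hbody s
          obtain ⟨u, hu⟩ := ih t (ht0.trans h0) (by omega) ht2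
          exact ⟨u, .loop_succ hz ht hu⟩
    obtain ⟨t, ht⟩ := hsearch k s₀ h₀.1 (by rw [h₀.2.1, zero_add]) h₀.2.2
    refine ⟨t, ?_⟩
    rw [length_program_machine]
    exact reaches_load.trans (hcode.reaches (.seq hs₀ ht))

theorem primrec_instr_inc : Primrec₂ Instr.inc :=
  (Primrec.of_equiv_symm.comp (Primrec.sumInl.comp Primrec.id) :
    Primrec fun x : ℕ × ℕ => Instr.equivSum.symm (Sum.inl x))

theorem primrec_instr_test :
    Primrec fun x : ℕ × ℕ × ℕ => Instr.test x.1 x.2.1 x.2.2 :=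
  (Primrec.of_equiv_symm.comp (Primrec.sumInr.comp Primrec.id) :
    Primrec fun x : ℕ × ℕ × ℕ => Instr.equivSum.symm (Sum.inr x))

theorem primrec_compile (c : Cmd) : Primrec₂ c.compile := by
  induction c with
  | inc j =>
    exact Primrec.list_cons.comp (primrec_instr_inc.comp (.const j) .snd) (.const [])
  | clear j =>
    exact Primrec.list_cons.comp (primrec_instr_test.comp
      (.pair (.const j) (.pair .snd .fst))) (.const [])
  | seq c d ihc ihd =>
    have : Primrec fun x : ℕ × ℕ => x.1 + c.length := Primrec.nat_add.comp .fst (.const _)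
    exact Primrec.list_append.comp (ihc.comp .fst this) (ihd.comp this .snd)
  | loop j c ih =>
    have : Primrec fun x : ℕ × ℕ => x.1 + 1 := Primrec.succ.comp .fst
    exact Primrec.list_cons.comp (primrec_instr_test.comp
      (.pair (.const j) (.pair .snd this))) (ih.comp this .fst)

theorem primrec_machine (c : Cmd) : Primrec (machine c) := by
  have h1 : Primrec loadInstrs :=
    Primrec.list_map Primrec.list_range
      (primrec_instr_inc.comp (.const 0) (Primrec.succ.comp .snd)).to₂
  have h2 : Primrec fun a => loadInstrs a ++ c.compile a (a + c.length) :=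
    Primrec.list_append.comp h1
      ((primrec_compile c).comp .id (Primrec.nat_add.comp .id (.const _)))
  exact (Primrec.of_equiv_symm.comp (.pair (.const _) h2) :
    Primrec fun a => CounterMachine.equivProd.symm
      (max 1 c.numCounters, loadInstrs a ++ c.compile a (a + c.length)))

end Cmd

/-- Kleene normal form: unbounded search for a counterexample is partial recursive, and step-bounded
evaluation of its code is primitive recursive in the bound `k`. -/
theorem IsPi01.exists_primrec {q : ℕ → Prop} (hq : IsPi01 q) :
    ∃ h : ℕ → ℕ → ℕ, Primrec₂ h ∧ ∀ a, ¬ q a ↔ ∃ k, h a k = 0 := by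
  obtain ⟨R, ⟨_, hR⟩, hqR⟩ := hq
  have hp : Partrec fun a : ℕ => Nat.rfind fun n => Part.some (!decide (R (a, n))) :=
    Partrec.rfind ((Primrec.not.to_comp.comp hR).partrec)
  obtain ⟨c, hc⟩ := Nat.Partrec.Code.exists_code.1 (Partrec.nat_iff.1 hp)
  refine ⟨fun a k => ((Nat.Partrec.Code.evaln k c a).casesOn 1 fun _ => 0 : ℕ), ?_, fun a => ?_⟩
  · exact Primrec.option_casesOn
      (Nat.Partrec.Code.primrec_evaln.comp (.pair (.pair .snd (.const c)) .fst))
      (.const 1) (.const 0)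
  · have h1 : ¬ q a ↔ (Nat.Partrec.Code.eval c a).Dom := by
      rw [hqR, hc, not_forall]
      refine Iff.trans ?_ Nat.rfind_dom.symm
      simp
    rw [h1, Part.dom_iff_mem]
    simp only [Nat.Partrec.Code.evaln_complete]
    rw [exists_comm]
    refine exists_congr fun k => ?_
    rcases Nat.Partrec.Code.evaln k c a with _ | x <;> simp

theorem IsPi01.exists_machine {q : ℕ → Prop} (hq : IsPi01 q) :
    ∃ f : ℕ → CounterMachine, Computable f ∧ ∀ a, q a ↔ ¬ (f a).Halts := by
  obtain ⟨h, hh, hqh⟩ := hq.exists_primrec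
  -- The inputs sit in counters `0` and `1` and the result in `2`, as `search` expects.
  obtain ⟨c, hc⟩ := Cmd.computes_of_primrec' (Nat.Primrec'.prim_iff₂.2 hh) 2
    (fun i => (i : ℕ)) fun i => i.is_lt
  refine ⟨Cmd.machine c.search, (Cmd.primrec_machine _).to_comp, fun a => ?_⟩
  rw [Cmd.halts_machine_search_iff (h := h), ← hqh, not_not]
  simpa [List.Vector.ofFn] using hc

/-! ### Bisimilarity of Petri nets is `Π⁰₁` -/

theorem Primrec.list_erase {α : Type*} [Primcodable α] [DecidableEq α] :
    Primrec₂ fun (l : List α) (a : α) => l.erase a := by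
  have h : Primrec fun x : List α × α =>
      x.1.take (x.1.idxOf x.2) ++ x.1.drop (x.1.idxOf x.2 + 1) := by
    have hi : Primrec fun x : List α × α => x.1.idxOf x.2 :=
      Primrec.list_idxOf.comp Primrec.snd Primrec.fst
    exact Primrec.list_append.comp (Primrec.list_take.comp hi .fst)
      (Primrec.list_drop.comp (Primrec.succ.comp hi) .fst)
  refine h.of_eq fun x => ?_
  rw [← List.eraseIdx_eq_take_drop_succ]
  exact (List.erase_eq_eraseIdx_of_idxOf rfl).symm

theorem Primrec.list_diff {α : Type*} [Primcodable α] [DecidableEq α] :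
    Primrec₂ fun l l' : List α => l.diff l' := by
  have h : Primrec fun x : List α × List α => x.2.foldl List.erase x.1 :=
    Primrec.list_foldl .snd .fst
      ((Primrec.list_erase (α := α)).comp (Primrec.fst.comp .snd) (Primrec.snd.comp .snd)).to₂
  exact h.of_eq fun x => (List.diff_eq_foldl _ _).symm

theorem primrecRel_mem_list {α : Type*} [Primcodable α] :
    PrimrecRel fun (x : α) (l : List α) => x ∈ l :=
  (PrimrecRel.exists_mem_list Primrec.eq).swap.of_eq fun x l => by simp [Function.swap]

theorem PrimrecPred.exists_mem {α β : Type*} [Primcodable α] [Primcodable β] {R : α × β → Prop}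
    {L : α → List β} (hR : PrimrecPred R) (hL : Primrec L) :
    PrimrecPred fun a => ∃ b ∈ L a, R (a, b) :=
  (PrimrecRel.exists_mem_list (R := fun b a => R (a, b))
    (hR.comp (.pair .snd .fst))).comp hL .id

theorem PrimrecPred.forall_mem {α β : Type*} [Primcodable α] [Primcodable β] {R : α × β → Prop}
    {L : α → List β} (hR : PrimrecPred R) (hL : Primrec L) :
    PrimrecPred fun a => ∀ b ∈ L a, R (a, b) :=
  (PrimrecRel.forall_mem_list (R := fun b a => R (a, b))
    (hR.comp (.pair .snd .fst))).comp hL .id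

namespace PNSystem

/-- The pairs of the action and the resulting marking of the transitions from a marking that is
presented by a list. -/
def successors (Δ : PNSystem) (l : List ℕ) : List (ℕ × List ℕ) :=
  Δ.filterMap fun r => if r.1.diff l = [] then some (r.2.1, r.2.2 ++ l.diff r.1) else none

theorem fires_coe_iff {Δ : PNSystem} {l : List ℕ} {a : ℕ} {m : Multiset ℕ} :
    Δ.Fires l a m ↔ ∃ l', (a, l') ∈ Δ.successors l ∧ m = (l' : Multiset ℕ) := by
  have hle : ∀ r : List ℕ, r.diff l = [] ↔ (r : Multiset ℕ) ≤ l := fun r => by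
    rw [← tsub_eq_zero_iff_le, Multiset.coe_sub, Multiset.coe_eq_zero]
  simp only [successors, List.mem_filterMap, Option.ite_none_right_eq_some, Option.some.injEq,
    Prod.mk.injEq, hle]
  constructor
  · rintro ⟨r, hr, γ, h, rfl, rfl⟩
    refine ⟨_, ⟨r, hr, ?_, rfl, rfl⟩, ?_⟩
    · rw [h]; exact Multiset.le_add_right _ _
    · rw [← Multiset.coe_add, ← Multiset.coe_sub, h, add_tsub_cancel_left]
  · rintro ⟨_, ⟨r, hr, h, rfl, rfl⟩, rfl⟩
    exact ⟨r, hr, (l : Multiset ℕ) - (r.1 : Multiset ℕ), (add_tsub_cancel_of_le h).symm, rfl, by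
      rw [← Multiset.coe_add, ← Multiset.coe_sub]⟩

theorem primrec_successors : Primrec₂ successors := by
  have hd : Primrec fun x : (PNSystem × List ℕ) × PNRule => x.2.1.diff x.1.2 :=
    Primrec.list_diff.comp (Primrec.fst.comp .snd) (Primrec.snd.comp .fst)
  have hd' : Primrec fun x : (PNSystem × List ℕ) × PNRule => x.1.2.diff x.2.1 :=
    Primrec.list_diff.comp (Primrec.snd.comp .fst) (Primrec.fst.comp .snd)
  exact Primrec.listFilterMap Primrec.fst (Primrec.ite (Primrec.eq.comp hd (.const []))
    (Primrec.option_some.comp (.pair (Primrec.fst.comp (Primrec.snd.comp .snd))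
      (Primrec.list_append.comp (Primrec.snd.comp (Primrec.snd.comp .snd)) hd')))
    (.const none)).to₂

theorem primrecPred_isMarking :
    PrimrecPred fun x : PNSystem × List ℕ => x.1.IsMarking (x.2 : Multiset ℕ) := by
  have h1 : PrimrecRel fun (r : PNRule) (x : ℕ) => x ∈ r.1 ∨ x ∈ r.2.2 := by
    exact (primrecRel_mem_list.comp .snd (Primrec.fst.comp .fst)).or
      (primrecRel_mem_list.comp .snd (Primrec.snd.comp (Primrec.snd.comp .fst)))
  have h2 : PrimrecRel fun (x : ℕ) (Δ : PNSystem) => Δ.IsPlace x := h1.exists_mem_list.swap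
  exact (h2.forall_mem_list.comp .snd .fst).of_eq fun x => by simp [IsMarking]

/-- A pair of markings of two systems is refuted by `L` if one side has a transition such that all
transitions of the other side with the same action lead to a pair in `L`. -/
def Refuted (Δ : PNSystem × PNSystem) (L : List (List ℕ × List ℕ)) (x : List ℕ × List ℕ) : Prop :=
  (∃ s ∈ Δ.1.successors x.1, ∀ t ∈ Δ.2.successors x.2, t.1 = s.1 → (s.2, t.2) ∈ L) ∨
    ∃ t ∈ Δ.2.successors x.2, ∀ s ∈ Δ.1.successors x.1, s.1 = t.1 → (s.2, t.2) ∈ L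

/-- A list of pairs of markings each of which is refuted by the part of the list after it. -/
def IsRefutation (Δ : PNSystem × PNSystem) (L : List (List ℕ × List ℕ)) : Prop :=
  ∀ k < L.length, Refuted Δ (L.drop (k + 1)) (L.getD k ([], []))

variable {Δ : PNSystem × PNSystem} {L L' : List (List ℕ × List ℕ)} {x : List ℕ × List ℕ}

theorem Refuted.mono (h : Refuted Δ L x) (hL : L ⊆ L') : Refuted Δ L' x :=
  h.imp (fun ⟨s, hs, h⟩ => ⟨s, hs, fun t ht e => hL (h t ht e)⟩)
    fun ⟨t, ht, h⟩ => ⟨t, ht, fun s hs e => hL (h s hs e)⟩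

theorem isRefutation_nil : IsRefutation Δ [] := fun k hk => by simp at hk

theorem isRefutation_cons :
    IsRefutation Δ (x :: L) ↔ Refuted Δ L x ∧ IsRefutation Δ L := by
  constructor
  · intro h
    exact ⟨h 0 (by simp), fun k hk => h (k + 1) (by simpa using hk)⟩
  · rintro ⟨h, hL⟩ (_ | k) hk
    · exact h
    · exact hL k (by simpa using hk)

theorem IsRefutation.append (h : IsRefutation Δ L) (h' : IsRefutation Δ L') :
    IsRefutation Δ (L ++ L') := by
  induction L with
  | nil => exact h'
  | cons x L ih =>
    rw [isRefutation_cons] at h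
    rw [List.cons_append, isRefutation_cons]
    exact ⟨h.1.mono (List.subset_append_left _ _), ih h.2⟩

/-- Refutations can be concatenated, because enlarging the list of refuted pairs preserves
`Refuted`. -/
theorem exists_isRefutation_of_forall {S : List (List ℕ × List ℕ)}
    (h : ∀ x ∈ S, ∃ L, IsRefutation Δ L ∧ x ∈ L) : ∃ L, IsRefutation Δ L ∧ S ⊆ L := by
  induction S with
  | nil => exact ⟨[], isRefutation_nil, by simp⟩
  | cons x S ih =>
    obtain ⟨L, hL, hx⟩ := h x (by simp)
    obtain ⟨L', hL', hS⟩ := ih fun y hy => h y (by simp [hy])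
    refine ⟨L ++ L', hL.append hL', fun y hy => ?_⟩
    rcases List.mem_cons.1 hy with rfl | hy
    · exact List.mem_append_left _ hx
    · exact List.mem_append_right _ (hS hy)

/-- Induction from the end of the list: a related pair at the head would force a related pair in the
tail. -/
theorem IsRefutation.not_rel {R : Multiset ℕ → Multiset ℕ → Prop}
    (hR : ∀ s u, R s u → ∀ a, (∀ s', Δ.1.Fires s a s' → ∃ u', Δ.2.Fires u a u' ∧ R s' u') ∧
      (∀ u', Δ.2.Fires u a u' → ∃ s', Δ.1.Fires s a s' ∧ R s' u'))
    (hL : IsRefutation Δ L) : ∀ x ∈ L, ¬ R (x.1 : Multiset ℕ) (x.2 : Multiset ℕ) := by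
  induction L with
  | nil => simp
  | cons y L ih =>
    obtain ⟨hy, hL⟩ := isRefutation_cons.1 hL
    have ih := ih hL
    intro x hx
    rcases List.mem_cons.1 hx with rfl | hx
    · intro h
      rcases hy with ⟨s, hs, hy⟩ | ⟨t, ht, hy⟩
      · obtain ⟨u, hu, hr⟩ := (hR _ _ h s.1).1 _ (fires_coe_iff.2 ⟨s.2, hs, rfl⟩)
        obtain ⟨t, ht, rfl⟩ := fires_coe_iff.1 hu
        exact ih _ (hy _ ht rfl) hr
      · obtain ⟨u, hu, hr⟩ := (hR _ _ h t.1).2 _ (fires_coe_iff.2 ⟨t.2, ht, rfl⟩)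
        obtain ⟨s, hs, rfl⟩ := fires_coe_iff.1 hu
        exact ih _ (hy _ hs rfl) hr
    · exact ih x hx

/-- The irrefutable pairs form a bisimulation: if every reply to some move were refutable, the
finitely many refutations, joined and prefixed with the pair itself, would refute it. -/
theorem bisimilar_iff_forall_isRefutation {Δ₁ Δ₂ : PNSystem} {l₁ l₂ : List ℕ} :
    (Δ₁.toLTS.disjointUnion Δ₂.toLTS).Bisimilar
      (Sum.inl (l₁ : Multiset ℕ)) (Sum.inr (l₂ : Multiset ℕ)) ↔
      ∀ L, IsRefutation (Δ₁, Δ₂) L → (l₁, l₂) ∉ L := by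
  refine LTS.disjointUnion_bisimilar_iff.trans ⟨?_, fun h => ?_⟩
  · rintro ⟨R, hR, h⟩ L hL hx
    exact hL.not_rel (Δ := (Δ₁, Δ₂)) hR _ hx h
  · refine ⟨fun m₁ m₂ => ∃ l₁ l₂ : List ℕ, m₁ = (l₁ : Multiset ℕ) ∧ m₂ = (l₂ : Multiset ℕ) ∧
      ∀ L, IsRefutation (Δ₁, Δ₂) L → (l₁, l₂) ∉ L, ?_, l₁, l₂, rfl, rfl, h⟩
    rintro _ _ ⟨l₁, l₂, rfl, rfl, h⟩ a
    have key : ∀ S, (∀ x ∈ S, ∃ L, IsRefutation (Δ₁, Δ₂) L ∧ x ∈ L) →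
        ¬ Refuted (Δ₁, Δ₂) S (l₁, l₂) := fun S hS hr => by
      obtain ⟨L, hL, hSL⟩ := exists_isRefutation_of_forall hS
      exact h _ (isRefutation_cons.2 ⟨hr.mono hSL, hL⟩) (by simp)
    constructor
    · intro m hm
      obtain ⟨l₁', hl, rfl⟩ := fires_coe_iff.1 hm
      by_contra hc
      -- The list consists of the pairs reached by all replies with action `a` to the unanswered
      -- move.
      refine key (((Δ₂.successors l₂).filter fun t => t.1 = a).map fun t => (l₁', t.2)) ?_
        (Or.inl ⟨_, hl, fun t ht e => List.mem_map.2 ⟨t, by simp [ht, e], rfl⟩⟩)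
      intro x hx
      obtain ⟨⟨a', t⟩, ht, rfl⟩ := List.mem_map.1 hx
      obtain ⟨ht', e⟩ := List.mem_filter.1 ht
      obtain rfl : a' = a := by simpa using e
      by_contra! hn
      exact hc ⟨_, fires_coe_iff.2 ⟨t, ht', rfl⟩, _, _, rfl, rfl, hn⟩
    · intro m hm
      obtain ⟨l₂', hl, rfl⟩ := fires_coe_iff.1 hm
      by_contra hc
      refine key (((Δ₁.successors l₁).filter fun s => s.1 = a).map fun s => (s.2, l₂')) ?_
        (Or.inr ⟨_, hl, fun s hs e => List.mem_map.2 ⟨s, by simp [hs, e], rfl⟩⟩)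
      intro x hx
      obtain ⟨⟨a', s⟩, hs, rfl⟩ := List.mem_map.1 hx
      obtain ⟨hs', e⟩ := List.mem_filter.1 hs
      obtain rfl : a' = a := by simpa using e
      by_contra! hn
      exact hc ⟨_, fires_coe_iff.2 ⟨s, hs', rfl⟩, _, _, rfl, rfl, hn⟩

theorem primrecPred_refuted :
    PrimrecPred fun p : ((PNSystem × PNSystem) × List (List ℕ × List ℕ)) × (List ℕ × List ℕ) =>
      Refuted p.1.1 p.1.2 p.2 := by
  have hs₁ : Primrec fun p : ((PNSystem × PNSystem) × List (List ℕ × List ℕ)) ×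
      (List ℕ × List ℕ) => p.1.1.1.successors p.2.1 :=
    primrec_successors.comp (Primrec.fst.comp (Primrec.fst.comp .fst)) (Primrec.fst.comp .snd)
  have hs₂ : Primrec fun p : ((PNSystem × PNSystem) × List (List ℕ × List ℕ)) ×
      (List ℕ × List ℕ) => p.1.1.2.successors p.2.2 :=
    primrec_successors.comp (Primrec.snd.comp (Primrec.fst.comp .fst)) (Primrec.snd.comp .snd)
  have himp : ∀ {β : Type} [Primcodable β] {s t : β → ℕ × List ℕ}
      {L : β → List (List ℕ × List ℕ)} {v : β → List ℕ × List ℕ}, Primrec s → Primrec t →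
      Primrec v → Primrec L → PrimrecPred fun x => (s x).1 = (t x).1 → v x ∈ L x :=
    fun hs ht hv hL => ((Primrec.eq.comp (Primrec.fst.comp hs) (Primrec.fst.comp ht)).not.or
      (primrecRel_mem_list.comp hv hL)).of_eq fun _ => imp_iff_not_or.symm
  have hL : Primrec fun p : (((((PNSystem × PNSystem) × List (List ℕ × List ℕ)) ×
      (List ℕ × List ℕ)) × (ℕ × List ℕ)) × (ℕ × List ℕ)) => p.1.1.1.2 :=
    Primrec.snd.comp (Primrec.fst.comp (Primrec.fst.comp .fst))
  have hs : Primrec fun p : (((((PNSystem × PNSystem) × List (List ℕ × List ℕ)) ×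
      (List ℕ × List ℕ)) × (ℕ × List ℕ)) × (ℕ × List ℕ)) => p.1.2 := Primrec.snd.comp .fst
  refine PrimrecPred.or ?_ ?_
  · exact ((himp .snd hs (.pair (Primrec.snd.comp hs) (Primrec.snd.comp .snd)) hL).forall_mem
      (hs₂.comp .fst)).exists_mem hs₁
  · exact ((himp .snd hs (.pair (Primrec.snd.comp .snd) (Primrec.snd.comp hs)) hL).forall_mem
      (hs₁.comp .fst)).exists_mem hs₂

theorem primrecPred_isRefutation :
    PrimrecPred fun p : (PNSystem × PNSystem) × List (List ℕ × List ℕ) =>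
      IsRefutation p.1 p.2 := by
  have h : PrimrecPred fun q : ((PNSystem × PNSystem) × List (List ℕ × List ℕ)) × ℕ =>
      Refuted q.1.1 (q.1.2.drop (q.2 + 1)) (q.1.2.getD q.2 ([], [])) :=
    primrecPred_refuted.comp (.pair (.pair (Primrec.fst.comp .fst)
      (Primrec.list_drop.comp (Primrec.succ.comp .snd) (Primrec.snd.comp .fst)))
      ((Primrec.list_getD ([], [])).comp (Primrec.snd.comp .fst) .snd))
  exact (h.forall_mem (Primrec.list_range.comp (Primrec.list_length.comp .snd))).of_eq
    fun p => by simp [IsRefutation]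

end PNSystem

theorem isPi01_pnBisimilarity : IsPi01 PNBisimilarity := by
  -- Numbers that decode to nothing give the empty list, which refutes no pair.
  let L : ℕ → List (List ℕ × List ℕ) := fun n => (Encodable.decode n).getD []
  have hL : Primrec L := Primrec.option_getD.comp Primrec.decode (.const [])
  refine ⟨fun x => x.1.1.1.IsMarking (x.1.1.2 : Multiset ℕ) ∧
    x.1.2.1.IsMarking (x.1.2.2 : Multiset ℕ) ∧
    ¬ (PNSystem.IsRefutation (x.1.1.1, x.1.2.1) (L x.2) ∧ (x.1.1.2, x.1.2.2) ∈ L x.2), ?_, ?_⟩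
  · have hfst : Primrec fun x : PNInstance × ℕ => x.1.1 := Primrec.fst.comp .fst
    have hsnd : Primrec fun x : PNInstance × ℕ => x.1.2 := Primrec.snd.comp .fst
    have hLx : Primrec fun x : PNInstance × ℕ => L x.2 := hL.comp .snd
    exact ((PNSystem.primrecPred_isMarking.comp hfst).and
      ((PNSystem.primrecPred_isMarking.comp hsnd).and
      ((PNSystem.primrecPred_isRefutation.comp
        (.pair (.pair (Primrec.fst.comp hfst) (Primrec.fst.comp hsnd)) hLx)).and
      (primrecRel_mem_list.comp (.pair (Primrec.snd.comp hfst) (Primrec.snd.comp hsnd))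
        hLx)).not)).computablePred
  · intro I
    simp only [PNBisimilarity, PNSystem.bisimilar_iff_forall_isRefutation, forall_and,
      forall_const, not_and]
    refine and_congr_right fun _ => and_congr_right fun _ => ⟨fun h n => h (L n), fun h l => ?_⟩
    simpa [L] using h (Encodable.encode l)

/-! ### Computability of the net of a counter machine -/

theorem Primrec.list_pair {α β : Type*} [Primcodable α] [Primcodable β] {f g : α → β}
    (hf : Primrec f) (hg : Primrec g) : Primrec fun a => [f a, g a] :=
  Primrec.list_cons.comp hf (Primrec.list_cons.comp hg (.const []))

theorem Primrec.list_singleton {α β : Type*} [Primcodable α] [Primcodable β] {f : α → β}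
    (hf : Primrec f) : Primrec fun a => [f a] :=
  Primrec.list_cons.comp hf (.const [])

namespace CounterNet

theorem primrec_C : Primrec C := Primrec.nat_mul.comp (.const 3) .id

theorem primrec_Q : Primrec Q := Primrec.nat_add.comp primrec_C (.const 1)

theorem primrec_Q' : Primrec Q' := Primrec.nat_add.comp primrec_C (.const 2)

theorem primrec_instrRules : Primrec₂ instrRules := by
  have h1 : Primrec₂ fun (x : ℕ × Instr) (y : ℕ × ℕ) => instrRules x.1 (.inc y.1 y.2) := by
    have hi : Primrec fun z : (ℕ × Instr) × (ℕ × ℕ) => z.1.1 := Primrec.fst.comp .fst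
    have hj : Primrec fun z : (ℕ × Instr) × (ℕ × ℕ) => z.2.1 := Primrec.fst.comp .snd
    have hk : Primrec fun z : (ℕ × Instr) × (ℕ × ℕ) => z.2.2 := Primrec.snd.comp .snd
    exact Primrec.list_pair
      (.pair (.list_singleton (primrec_Q.comp hi))
        (.pair (.const _) (.list_pair (primrec_Q.comp hk) (primrec_C.comp hj))))
      (.pair (.list_singleton (primrec_Q'.comp hi))
        (.pair (.const _) (.list_pair (primrec_Q'.comp hk) (primrec_C.comp hj))))
  have h2 : Primrec₂ fun (x : ℕ × Instr) (y : ℕ × ℕ × ℕ) =>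
      instrRules x.1 (.test y.1 y.2.1 y.2.2) := by
    have hi : Primrec fun z : (ℕ × Instr) × (ℕ × ℕ × ℕ) => z.1.1 := Primrec.fst.comp .fst
    have hj : Primrec fun z : (ℕ × Instr) × (ℕ × ℕ × ℕ) => C z.2.1 :=
      primrec_C.comp (Primrec.fst.comp .snd)
    have hk : Primrec fun z : (ℕ × Instr) × (ℕ × ℕ × ℕ) => z.2.2.1 :=
      Primrec.fst.comp (Primrec.snd.comp .snd)
    have hl : Primrec fun z : (ℕ × Instr) × (ℕ × ℕ × ℕ) => z.2.2.2 :=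
      Primrec.snd.comp (Primrec.snd.comp .snd)
    have hQi := primrec_Q.comp hi
    have hQi' := primrec_Q'.comp hi
    have hQk := primrec_Q.comp hk
    have hQk' := primrec_Q'.comp hk
    exact Primrec.list_cons.comp
      (.pair (.list_pair hQi hj) (.pair (.const _) (.list_singleton (primrec_Q.comp hl)))) <|
      Primrec.list_cons.comp
      (.pair (.list_pair hQi' hj) (.pair (.const _) (.list_singleton (primrec_Q'.comp hl)))) <|
      Primrec.list_cons.comp
      (.pair (.list_singleton hQi) (.pair (.const _) (.list_singleton hQk))) <|
      Primrec.list_cons.comp (.pair (.list_pair hQi hj) (.pair (.const _) (.list_pair hQk' hj))) <|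
      Primrec.list_cons.comp (.pair (.list_pair hQi' hj) (.pair (.const _) (.list_pair hQk hj))) <|
      Primrec.list_singleton (.pair (.list_singleton hQi') (.pair (.const _) (.list_singleton hQk')))
  have he : Primrec fun x : ℕ × Instr => Instr.equivSum x.2 := Primrec.of_equiv.comp .snd
  refine (Primrec.sumCasesOn he h1 h2).of_eq fun x => ?_
  rcases x with ⟨i, ⟨j, k⟩ | ⟨j, k, l⟩⟩ <;> rfl

theorem primrec_net : Primrec net := by
  have hp : Primrec CounterMachine.program :=
    (Primrec.snd.comp Primrec.of_equiv : Primrec fun M => (CounterMachine.equivProd M).2)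
  have hn : Primrec fun M : CounterMachine => M.program.length := Primrec.list_length.comp hp
  have hg : Primrec₂ fun (M : CounterMachine) (i : ℕ) =>
      (M.program[i]?.map (instrRules i)).getD [] :=
    Primrec.option_getD.comp (Primrec.option_map
      (Primrec.list_getElem?.comp (hp.comp .fst) .snd)
      (primrec_instrRules.comp (Primrec.snd.comp .fst) .snd).to₂) (.const [])
  refine (Primrec.list_cons.comp (.pair (.list_singleton (primrec_Q.comp hn))
    (.const (hlt, []))) (Primrec.list_flatMap (Primrec.list_range.comp hn) hg)).of_eq fun M => ?_
  simp only [net, List.cons.injEq, true_and]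
  rw [List.flatMap_def, List.flatMap_def]
  congr 1
  -- Within the range of labels the lookup always succeeds, so the default `[]` never occurs.
  exact List.ext_getElem (by simp) fun i h _ => by simp at h; simp [h]

theorem computable_bisimInstance : Computable bisimInstance :=
  (Primrec.pair (.pair primrec_net (.const _)) (.pair primrec_net (.const _))).to_comp

end CounterNet

/-! ### Completeness and undecidability -/

theorem isPi01Complete_pnBisimilarity : IsPi01Complete PNBisimilarity := by
  refine ⟨isPi01_pnBisimilarity, fun q hq => ?_⟩
  obtain ⟨f, hf, hqf⟩ := hq.exists_machine
  exact ⟨fun a => CounterNet.bisimInstance (f a), CounterNet.computable_bisimInstance.comp hf,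
    fun a => (hqf a).trans (CounterNet.pnBisimilarity_bisimInstance_iff _).symm⟩

open Nat.Partrec in
theorem isPi01_not_halting :
    IsPi01 fun n : ℕ => ¬ (Code.eval (Denumerable.ofNat Code n) 0).Dom := by
  refine ⟨fun x => Code.evaln x.2 (Denumerable.ofNat Code x.1) 0 = Option.none, ?_, fun n => ?_⟩
  · exact (Primrec.eq.comp (Code.primrec_evaln.comp (.pair (.pair .snd
      ((Primrec.ofNat Code).comp .fst)) (.const 0))) (.const Option.none)).computablePred
  · simp only [Part.dom_iff_mem, Code.evaln_complete, Option.eq_none_iff_forall_not_mem]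
    push Not
    exact forall_comm

open Nat.Partrec in
-- The non-halting problem for codes reduces to `p`, so a decision procedure for `p` would make it
-- recursively enumerable.
theorem not_computablePred_of_isPi01Complete {α : Type} [Primcodable α] {p : α → Prop}
    (hp : IsPi01Complete p) : ¬ ComputablePred p := fun h => by
  have h1 := ComputablePred.computable_of_manyOneReducible (hp.2 _ isPi01_not_halting) h
  have h2 : (fun c : Code => ¬ (Code.eval c 0).Dom) ≤₀
      fun n : ℕ => ¬ (Code.eval (Denumerable.ofNat Code n) 0).Dom :=
    ⟨Encodable.encode, Computable.encode, fun c => by simp⟩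
  exact ComputablePred.halting_problem_not_re 0
    (ComputablePred.computable_of_manyOneReducible h2 h1).to_re

theorem mainTheorem2 :
    ¬ ComputablePred PNBisimilarity ∧
    (Computable CounterNet.bisimInstance ∧
      ∀ M : CounterMachine, M.WellFormed →
        ((CounterNet.net M).toLTS.Bisimilar
            ({CounterNet.Q 0} : Multiset ℕ) ({CounterNet.Q' 0} : Multiset ℕ) ↔ ¬ M.Halts) ∧
        (PNBisimilarity (CounterNet.bisimInstance M) ↔ ¬ M.Halts)) ∧
    IsPi01Complete PNBisimilarity :=
  ⟨not_computablePred_of_isPi01Complete isPi01Complete_pnBisimilarity,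
    ⟨CounterNet.computable_bisimInstance, fun M _ =>
      ⟨CounterNet.bisimilar_iff_not_halts M, CounterNet.pnBisimilarity_bisimInstance_iff M⟩⟩,
    isPi01Complete_pnBisimilarity⟩
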